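/- There are a program for the real RAM and a constant $C$ such that the following holds for all integers $d\ge 1$ and $k\ge 0$ and every symmetric positive semidefinite matrix $M\in\mathbb{R}^{d\times d}$ with $\operatorname{Tr}(M)\le k$ and $\operatorname{rank}(M)\le k$: on input $(d,k,M)$ the program halts after at most $C\,(d^3+kd)$ steps and outputs vectors $x^1,\dots,x^k\in\mathbb{R}^d$ with $\|x^i\|_2\le 1$ for $i=1,\dots,k$ and $$M=\sum_{i=1}^k x^i(x^i)^{\top}.$$ In other words, such vectors $x^1,\dots,x^k$ can be computed from $M$ in time $O(d^3+kd)$. Here a real RAM works with exact real numbers and charges one step for each instruction and each test: assignment with a rational constant, $+$, $-$, $\times$, $/$ (with non-zero divisor) and $\sqrt{\cdot}$ (of a non-negative number) on reals; assignment with a constant, $+$ and truncated $-$ on natural numbers, which serve as counters and array indices; reading and writing entries of real two-dimensional arrays; and comparisons ($<$, $=$) of two reals or of two natural numbers. Programs are finite, are built by sequencing, branching and while loops, and do not depend on $d$, $k$ or $M$; copying a register and the empty instruction also cost one step. -/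

import Mathlib

/-! A real RAM: a structured program over natural-number registers, real registers and
finitely many named two-dimensional real arrays. Every instruction and every test costs one
time unit. Natural numbers are used for counting and indexing only, and there is no rounding
or other conversion from reals to natural numbers. -/

namespace RealRAM

/-- A memory state: natural-number registers, real registers, and real arrays; `mat a i j` is
the entry in row `i` and column `j` of the array named `a`. -/
structure State where
  nat : ℕ → ℕ
  real : ℕ → ℝ
  mat : ℕ → ℕ → ℕ → ℝ

/-- Right-hand sides of assignments to natural-number registers; `y`, `z` are register names
and `sub` is truncated subtraction. -/
inductive NatOp where
  | const (c : ℕ)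
  | copy (y : ℕ)
  | add (y z : ℕ)
  | sub (y z : ℕ)

/-- Right-hand sides of assignments to real registers. `y`, `z` name real registers; `load a i j`
reads the array named `a` at the position held by the natural-number registers `i` and `j`. -/
inductive RealOp where
  | const (q : ℚ)
  | copy (y : ℕ)
  | add (y z : ℕ)
  | sub (y z : ℕ)
  | mul (y z : ℕ)
  | div (y z : ℕ)
  | sqrt (y : ℕ)
  | load (a i j : ℕ)

/-- Instructions; `store a i j y` writes the real register `y` into the array named `a` at the
position held by the natural-number registers `i` and `j`. -/
inductive Instr where
  | setNat (x : ℕ) (e : NatOp)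
  | setReal (x : ℕ) (e : RealOp)
  | store (a i j y : ℕ)

/-- Comparisons of two natural-number registers or of two real registers. -/
inductive Test where
  | natLt (y z : ℕ)
  | natEq (y z : ℕ)
  | realLt (y z : ℕ)
  | realEq (y z : ℕ)

/-- Programs. A program is a finite text; it does not depend on the input. -/
inductive Prog where
  | skip
  | instr (c : Instr)
  | seq (p q : Prog)
  | cond (b : Test) (p q : Prog)
  | loop (b : Test) (p : Prog)

def NatOp.eval (σ : State) : NatOp → ℕ
  | .const c => c
  | .copy y => σ.nat y
  | .add y z => σ.nat y + σ.nat z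
  | .sub y z => σ.nat y - σ.nat z

/-- An operation is legal unless it divides by zero or takes the root of a negative number. -/
def RealOp.Legal (σ : State) : RealOp → Prop
  | .div _ z => σ.real z ≠ 0
  | .sqrt y => 0 ≤ σ.real y
  | _ => True

noncomputable def RealOp.eval (σ : State) : RealOp → ℝ
  | .const q => (q : ℝ)
  | .copy y => σ.real y
  | .add y z => σ.real y + σ.real z
  | .sub y z => σ.real y - σ.real z
  | .mul y z => σ.real y * σ.real z
  | .div y z => σ.real y / σ.real z
  | .sqrt y => Real.sqrt (σ.real y)
  | .load a i j => σ.mat a (σ.nat i) (σ.nat j)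

def Instr.Legal (σ : State) : Instr → Prop
  | .setReal _ e => e.Legal σ
  | _ => True

noncomputable def Instr.exec (σ : State) : Instr → State
  | .setNat x e => { σ with nat := Function.update σ.nat x (e.eval σ) }
  | .setReal x e => { σ with real := Function.update σ.real x (e.eval σ) }
  | .store a i j y =>
      { σ with mat := Function.update σ.mat a (Function.update (σ.mat a) (σ.nat i)
          (Function.update (σ.mat a (σ.nat i)) (σ.nat j) (σ.real y))) }

def Test.Holds (σ : State) : Test → Prop
  | .natLt y z => σ.nat y < σ.nat z
  | .natEq y z => σ.nat y = σ.nat z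
  | .realLt y z => σ.real y < σ.real z
  | .realEq y z => σ.real y = σ.real z

/-- `Exec p σ t τ`: started in the state `σ`, the program `p` halts after exactly `t` time units
in the state `τ`. A program that reaches an illegal instruction, or that never halts, has no
final state. -/
inductive Exec : Prog → State → ℕ → State → Prop where
  | skip {σ : State} : Exec .skip σ 1 σ
  | instr {c : Instr} {σ : State} (h : c.Legal σ) : Exec (.instr c) σ 1 (c.exec σ)
  | seq {p q : Prog} {σ τ υ : State} {s t : ℕ} (hp : Exec p σ s τ) (hq : Exec q τ t υ) :
      Exec (.seq p q) σ (s + t) υ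
  | condTrue {b : Test} {p q : Prog} {σ τ : State} {t : ℕ} (hb : b.Holds σ)
      (hp : Exec p σ t τ) : Exec (.cond b p q) σ (t + 1) τ
  | condFalse {b : Test} {p q : Prog} {σ τ : State} {t : ℕ} (hb : ¬ b.Holds σ)
      (hq : Exec q σ t τ) : Exec (.cond b p q) σ (t + 1) τ
  | loopDone {b : Test} {p : Prog} {σ : State} (hb : ¬ b.Holds σ) :
      Exec (.loop b p) σ 1 σ
  | loopStep {b : Test} {p : Prog} {σ τ υ : State} {s t : ℕ} (hb : b.Holds σ)
      (hp : Exec p σ s τ) (hl : Exec (.loop b p) τ t υ) :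
      Exec (.loop b p) σ (s + t + 1) υ

/-- The semantics is deterministic: final state and running time are unique. -/
theorem Exec.unique {p : Prog} {σ τ τ' : State} {t t' : ℕ} (h : Exec p σ t τ)
    (h' : Exec p σ t' τ') : t = t' ∧ τ = τ' := by
  induction h generalizing t' τ' with
  | skip => cases h'; exact ⟨rfl, rfl⟩
  | instr _ => cases h'; exact ⟨rfl, rfl⟩
  | seq _ _ ihp ihq =>
    cases h' with
    | seq hp hq =>
      obtain ⟨rfl, rfl⟩ := ihp hp
      obtain ⟨rfl, rfl⟩ := ihq hq
      exact ⟨rfl, rfl⟩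
  | condTrue hb _ ih =>
    cases h' with
    | condTrue _ hp => obtain ⟨rfl, rfl⟩ := ih hp; exact ⟨rfl, rfl⟩
    | condFalse hb' _ => exact absurd hb hb'
  | condFalse hb _ ih =>
    cases h' with
    | condTrue hb' _ => exact absurd hb' hb
    | condFalse _ hp => obtain ⟨rfl, rfl⟩ := ih hp; exact ⟨rfl, rfl⟩
  | loopDone hb =>
    cases h' with
    | loopDone _ => exact ⟨rfl, rfl⟩
    | loopStep hb' _ _ => exact absurd hb' hb
  | loopStep hb _ _ ihp ihl =>
    cases h' with
    | loopDone hb' => exact absurd hb hb'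
    | loopStep _ hp hl =>
      obtain ⟨rfl, rfl⟩ := ihp hp
      obtain ⟨rfl, rfl⟩ := ihl hl
      exact ⟨rfl, rfl⟩

/-- Input convention: the natural-number registers 0 and 1 hold `d` and `k`, and the array 0
holds the matrix `M`. Nothing is assumed about the rest of the memory. -/
def State.IsInput (σ : State) (d k : ℕ) (M : Matrix (Fin d) (Fin d) ℝ) : Prop :=
  σ.nat 0 = d ∧ σ.nat 1 = k ∧ ∀ i j : Fin d, σ.mat 0 i j = M i j

/-- Output convention: the `i`-th output vector is the `i`-th column of the array 1, read as a
vector of Euclidean `d`-space. -/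
noncomputable def State.output (τ : State) (d k : ℕ) (i : Fin k) : EuclideanSpace ℝ (Fin d) :=
  WithLp.toLp 2 fun j => τ.mat 1 j i

end RealRAM

/-! A positive semidefinite `M` of rank and trace at most `k` is first written as a sum of `k`
outer products of arbitrary vectors, which are then rotated against each other until none is
longer than `1`.

*Factorization.* The Cholesky algorithm runs over the diagonal of the matrix. A zero diagonal
entry of a positive semidefinite matrix forces a zero row and column
(`col_eq_zero_of_diag_eq_zero`), so such a pivot is skipped. At a positive pivot the outer product
of the scaled pivot column (`cholCol`) is subtracted; what remains is positive semidefinite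
(`PosSemidef.sub_cholCol`) and of smaller rank (`rank_sub_cholCol_lt`). Hence at most
`M.rank ≤ k` columns arise, and they fit into the `k` columns of the output array, the others being
zero. Each of the `d` pivots costs `O(d ^ 2)`.

*Balancing.* Replacing two vectors `u`, `v` by `c u - s v` and `s u + c v` with `c ^ 2 + s ^ 2 = 1`
preserves the sum of outer products (`IsRotation.sum_vecMulVec`), and if one of them is longer and
the other shorter than `1`, the angle can be chosen, with one square root for the tangent and one
for the cosine, such that the first becomes a unit vector (`IsRotation.left_dotProduct_self`).
Two pointers search for a vector longer than `1` and for one shorter than `1`. All vectors behind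
the first pointer have norm at most `1`, all those behind the second at least `1`. When both
pointers have found their vector, the one with the smaller index is made a unit vector, which
satisfies both conditions, and its pointer advances; the other vector has not been passed by either
pointer, so that its new length is unconstrained. The process ends after at most `2 k` pointer
moves of cost `O(d)`: either the first pointer has passed all vectors, or the second one has, and
then all norms are at least `1` while the sum of their squares is the trace, which is at most `k`,
so that all norms are `1` (`BalInv.le_one_of_nat9_eq`).

The running time and the effect of programs are derived together, by a Hoare calculus for the
relation `Runs` with rules for while loops and counting loops. -/

namespace RealRAM

/-! ### Reasoning about programs -/

/-- Total correctness with a time bound: started in `σ`, the program `p` halts after at most `T`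
steps in a state satisfying `Q`. -/
def Runs (p : Prog) (σ : State) (T : ℕ) (Q : State → Prop) : Prop :=
  ∃ (t : ℕ) (τ : State), Exec p σ t τ ∧ t ≤ T ∧ Q τ

theorem Runs.mono {p : Prog} {σ : State} {S T : ℕ} {P Q : State → Prop} (h : Runs p σ S P)
    (hST : S ≤ T) (hPQ : ∀ τ, P τ → Q τ) : Runs p σ T Q := by
  obtain ⟨t, τ, he, ht, hP⟩ := h
  exact ⟨t, τ, he, ht.trans hST, hPQ τ hP⟩

theorem Runs.seq {p q : Prog} {σ : State} {S T : ℕ} {P Q : State → Prop} (hp : Runs p σ S P)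
    (hq : ∀ τ, P τ → Runs q τ T Q) : Runs (.seq p q) σ (S + T) Q := by
  obtain ⟨s, τ, hs, hsS, hP⟩ := hp
  obtain ⟨t, υ, ht, htT, hQ⟩ := hq τ hP
  exact ⟨s + t, υ, .seq hs ht, add_le_add hsS htT, hQ⟩

theorem Runs.cond {b : Test} {p q : Prog} {σ : State} {T : ℕ} {Q : State → Prop}
    (hp : b.Holds σ → Runs p σ T Q) (hq : ¬ b.Holds σ → Runs q σ T Q) :
    Runs (.cond b p q) σ (T + 1) Q := by
  by_cases hb : b.Holds σ
  · obtain ⟨t, τ, ht, htT, hQ⟩ := hp hb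
    exact ⟨t + 1, τ, .condTrue hb ht, by omega, hQ⟩
  · obtain ⟨t, τ, ht, htT, hQ⟩ := hq hb
    exact ⟨t + 1, τ, .condFalse hb ht, by omega, hQ⟩

/-- A while loop with invariant `I` whose body decreases the measure `μ`. -/
theorem Runs.loop {b : Test} {p : Prog} {T : ℕ} (I : State → Prop) (μ : State → ℕ)
    (hp : ∀ σ, I σ → b.Holds σ → Runs p σ T fun τ => I τ ∧ μ τ < μ σ) {σ : State} (hσ : I σ) :
    Runs (.loop b p) σ (μ σ * (T + 1) + 1) fun τ => I τ ∧ ¬ b.Holds τ := by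
  induction hn : μ σ using Nat.strong_induction_on generalizing σ with
  | _ n ih =>
    by_cases hb : b.Holds σ
    · obtain ⟨s, τ, hs, hsT, hτ, hlt⟩ := hp σ hσ hb
      obtain ⟨t, υ, ht, htT, hQ⟩ := ih (μ τ) (hn ▸ hlt) hτ rfl
      refine ⟨s + t + 1, υ, .loopStep hb hs ht, ?_, hQ⟩
      have : (μ τ + 1) * (T + 1) ≤ n * (T + 1) := Nat.mul_le_mul_right _ (by omega)
      rw [add_mul] at this
      omega
    · exact ⟨1, σ, .loopDone hb, by omega, hσ, hb⟩

/-- A straight-line program. -/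
def block : List Instr → Prog
  | [] => .skip
  | c :: cs => .seq (.instr c) (block cs)

/-- The effect of a straight-line program. -/
noncomputable def execs (σ : State) : List Instr → State
  | [] => σ
  | c :: cs => execs (c.exec σ) cs

/-- No instruction of the straight-line program is illegal when it is reached. -/
def Legals (σ : State) : List Instr → Prop
  | [] => True
  | c :: cs => c.Legal σ ∧ Legals (c.exec σ) cs

theorem Runs.block {cs : List Instr} {σ : State} {Q : State → Prop} (hl : Legals σ cs)
    (hQ : Q (execs σ cs)) : Runs (block cs) σ (cs.length + 1) Q := by
  induction cs generalizing σ with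
  | nil => exact ⟨1, σ, .skip, by simp, hQ⟩
  | cons c cs ih =>
    obtain ⟨t, τ, ht, hT, hQ⟩ := ih hl.2 hQ
    exact ⟨1 + t, τ, .seq (.instr hl.1) ht, by simp; omega, hQ⟩

theorem Runs.block_seq {cs : List Instr} {p : Prog} {σ : State} {T : ℕ} {Q : State → Prop}
    (hl : Legals σ cs) (h : Runs p (execs σ cs) T Q) :
    Runs (.seq (RealRAM.block cs) p) σ (cs.length + 1 + T) Q :=
  (Runs.block (Q := (· = execs σ cs)) hl rfl).seq fun _ hτ => hτ ▸ h

/-- `for x < y do p`: the natural-number register `x` counts from `0` up to the value of the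
register `y`. Register 3 is assumed to hold the constant `1`. -/
def countLoop (x y : ℕ) (p : Prog) : Prog :=
  .seq (block [.setNat x (.const 0)])
    (.loop (.natLt x y) (.seq p (block [.setNat x (.add x 3)])))

/-- A counting loop of `N` rounds: `I m` is the invariant after `m` rounds. -/
theorem Runs.countLoop {x y : ℕ} {p : Prog} {N T : ℕ} (I : ℕ → State → Prop)
    (hI : ∀ m τ, I m τ → τ.nat x = m ∧ τ.nat y = N)
    (hp : ∀ m τ, m < N → I m τ → Runs p τ T fun υ =>
      I (m + 1) { υ with nat := Function.update υ.nat x (υ.nat x + υ.nat 3) })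
    {σ : State} (h0 : I 0 { σ with nat := Function.update σ.nat x 0 }) :
    Runs (countLoop x y p) σ (N * (T + 3) + 3) (I N) := by
  have hloop := Runs.loop (b := .natLt x y) (p := .seq p (RealRAM.block [.setNat x (.add x 3)]))
    (T := T + 2) (fun τ => ∃ m ≤ N, I m τ) (fun τ => N - τ.nat x) (by
      rintro τ ⟨m, hm, hIm⟩ hb
      obtain ⟨hx, hy⟩ := hI m τ hIm
      have hmN : m < N := by simpa [Test.Holds, hx, hy] using hb
      refine (hp m τ hmN hIm).seq fun υ hυ => Runs.block ⟨trivial, trivial⟩ ?_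
      refine ⟨⟨m + 1, hmN, hυ⟩, ?_⟩
      have := (hI _ _ hυ).1
      simp only [execs, Instr.exec, NatOp.eval] at this ⊢
      rw [this, hx]
      omega) ⟨0, Nat.zero_le _, h0⟩
  have hx0 : N - (Function.update σ.nat x 0) x = N := by simp
  refine (Runs.block_seq (cs := [.setNat x (.const 0)]) ⟨trivial, trivial⟩ hloop).mono ?_ ?_
  · simp only [hx0, List.length]
    lia
  · rintro τ ⟨⟨m, hm, hIm⟩, hb⟩
    obtain ⟨hx, hy⟩ := hI m τ hIm
    have : ¬ m < N := by simpa [Test.Holds, hx, hy] using hb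
    rwa [show m = N by omega] at hIm

/-! ### Columns of the output array and the working matrix -/

/-- Column `c` of the array 1, cut off after `d` entries. -/
def State.col (σ : State) (d c : ℕ) : Fin d → ℝ := fun l => σ.mat 1 l c

theorem State.col_congr {σ τ : State} (d : ℕ) (h : τ.mat 1 = σ.mat 1) : τ.col d = σ.col d := by
  funext c l
  exact congrFun₂ h l c

/-- The `d × d` matrix held by the array 0. -/
def State.work (σ : State) (d : ℕ) : Matrix (Fin d) (Fin d) ℝ := Matrix.of fun i j => σ.mat 0 i j

/-- `v` agrees with `u` outside the finite set `s`: the registers in `s` are scratch. -/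
def AgreeOff {α : Type*} (s : Finset ℕ) (u v : ℕ → α) : Prop := ∀ x ∉ s, v x = u x

/-! ### The subroutines -/

/-- Sets the `d × k` part of the array 1 to zero. -/
def clearProg : Prog :=
  .seq (block [.setReal 0 (.const 0)])
    (countLoop 5 0 (countLoop 6 1 (block [.store 1 5 6 0])))

/-- Sets the real register `r` to the inner product of the columns of the array 1 named by the
natural-number registers `p` and `q`. -/
def dotProg (p q r : ℕ) : Prog :=
  .seq (block [.setReal r (.const 0)])
    (countLoop 5 0 (block [.setReal 5 (.load 1 5 p), .setReal 6 (.load 1 5 q),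
      .setReal 5 (.mul 5 6), .setReal r (.add r 5)]))

/-- Replaces the columns `u`, `v` of the array 1 named by the natural-number registers 10 and 11
by `c u - s v` and `s u + c v`, where the real registers 7 and 8 hold `c` and `s`. -/
def applyRotProg : Prog :=
  countLoop 5 0 (block [.setReal 5 (.load 1 5 10), .setReal 6 (.load 1 5 11),
    .setReal 9 (.mul 7 5), .setReal 10 (.mul 8 6), .setReal 9 (.sub 9 10), .store 1 5 10 9,
    .setReal 9 (.mul 8 5), .setReal 10 (.mul 7 6), .setReal 9 (.add 9 10), .store 1 5 11 9])

theorem runs_clearProg {σ : State} {d k : ℕ} (hd : σ.nat 0 = d) (hk : σ.nat 1 = k)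
    (h3 : σ.nat 3 = 1) :
    Runs clearProg σ (5 + d * (k * 5 + 6)) fun τ =>
      AgreeOff {5, 6} σ.nat τ.nat ∧ (∀ a ≠ 1, τ.mat a = σ.mat a) ∧
      ∀ l < d, ∀ c < k, τ.mat 1 l c = 0 := by
  refine (Runs.block_seq (cs := [.setReal 0 (.const 0)]) ⟨trivial, trivial⟩
    (Runs.countLoop (N := d) (T := k * 5 + 3) (fun m υ =>
      AgreeOff {5, 6} σ.nat υ.nat ∧ (∀ a ≠ 1, υ.mat a = σ.mat a) ∧ υ.nat 5 = m ∧ υ.real 0 = 0 ∧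
      ∀ l < m, ∀ c < k, υ.mat 1 l c = 0) ?_ ?_ ?_)).mono ?_ ?_
  · rintro m υ ⟨h1, h2, h4, h5, h6⟩
    exact ⟨h4, by rw [h1 0 (by decide), hd]⟩
  · rintro m υ hm ⟨h1, h2, h4, h5, h6⟩
    refine (Runs.countLoop (N := k) (T := 2) (fun n ρ =>
      AgreeOff {5, 6} σ.nat ρ.nat ∧ (∀ a ≠ 1, ρ.mat a = σ.mat a) ∧ ρ.nat 5 = m ∧ ρ.nat 6 = n ∧
      ρ.real 0 = 0 ∧ (∀ l < m, ∀ c < k, ρ.mat 1 l c = 0) ∧ ∀ c < n, ρ.mat 1 m c = 0)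
      ?_ ?_ ?_).mono le_rfl ?_
    · rintro n ρ ⟨g1, g2, g3, g4, g5, g6, g7⟩
      exact ⟨g4, by rw [g1 1 (by decide), hk]⟩
    · rintro n ρ hn ⟨g1, g2, g3, g4, g5, g6, g7⟩
      refine Runs.block ⟨trivial, trivial⟩ ?_
      have g8 : ρ.nat 3 = 1 := by rw [g1 3 (by decide), h3]
      refine ⟨?_, ?_, ?_, ?_, ?_, ?_, ?_⟩
      · intro x hx
        have := g1 x hx
        simp_all [execs, Instr.exec]
      · intro a ha
        simpa [execs, Instr.exec, Function.update_apply, ha] using g2 a ha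
      · simpa [execs, Instr.exec] using g3
      · simp [execs, Instr.exec, g4, g8]
      · simpa [execs, Instr.exec] using g5
      · intro l hl c hc
        have : l ≠ m := by omega
        simpa [execs, Instr.exec, Function.update_apply, g3, this] using g6 l hl c hc
      · intro c hc
        simp only [execs, Instr.exec, Function.update_apply, g3, g4, g5]
        by_cases hcn : c = n
        · simp [hcn]
        · simpa [hcn] using g7 c (by omega)
    · refine ⟨?_, h2, ?_, ?_, h5, h6, ?_⟩
      · intro x hx
        have := h1 x hx
        simp_all
      · simpa using h4
      · simp
      · simp
    · rintro ρ ⟨g1, g2, g3, g4, g5, g6, g7⟩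
      have g8 : ρ.nat 3 = 1 := by rw [g1 3 (by decide), h3]
      refine ⟨?_, g2, ?_, g5, ?_⟩
      · intro x hx
        have := g1 x hx
        simp_all
      · simp [g3, g8]
      · intro l hl c hc
        rcases Nat.lt_succ_iff_lt_or_eq.mp hl with hl | rfl
        · exact g6 l hl c hc
        · exact g7 c hc
  · refine ⟨?_, fun _ _ => rfl, by simp, by simp [execs, Instr.exec, RealOp.eval], by simp⟩
    intro x hx
    simp_all [execs, Instr.exec]
  · simp only [List.length]
    lia
  · rintro υ ⟨h1, h2, h4, h5, h6⟩
    exact ⟨h1, h2, h6⟩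

theorem runs_dotProg {σ : State} {d : ℕ} (hd : σ.nat 0 = d) (h3 : σ.nat 3 = 1) {p q r : ℕ}
    (hp : p ≠ 5) (hq : q ≠ 5) (hr5 : r ≠ 5) (hr6 : r ≠ 6) :
    Runs (dotProg p q r) σ (5 + d * 8) fun τ =>
      AgreeOff {5} σ.nat τ.nat ∧ AgreeOff {5, 6, r} σ.real τ.real ∧ τ.mat = σ.mat ∧
      τ.real r = σ.col d (σ.nat p) ⬝ᵥ σ.col d (σ.nat q) := by
  refine (Runs.block_seq (cs := [.setReal r (.const 0)]) ⟨trivial, trivial⟩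
    (Runs.countLoop (N := d) (T := 5) (fun m υ =>
      AgreeOff {5} σ.nat υ.nat ∧ AgreeOff {5, 6, r} σ.real υ.real ∧ υ.mat = σ.mat ∧ υ.nat 5 = m ∧
      υ.real r = ∑ l ∈ Finset.range m, σ.mat 1 l (σ.nat p) * σ.mat 1 l (σ.nat q))
      ?_ ?_ ?_)).mono ?_ ?_
  · rintro m υ ⟨h1, h2, h4, h5, h6⟩
    exact ⟨h5, by rw [h1 0 (by decide), hd]⟩
  · rintro m υ hm ⟨h1, h2, h4, h5, h6⟩
    refine Runs.block (by simp [Legals, Instr.Legal, RealOp.Legal]) ?_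
    have g3 : υ.nat 3 = 1 := by rw [h1 3 (by decide), h3]
    have gp : υ.nat p = σ.nat p := h1 p (by simpa using hp)
    have gq : υ.nat q = σ.nat q := h1 q (by simpa using hq)
    refine ⟨?_, ?_, ?_, ?_, ?_⟩
    · intro x hx
      have := h1 x hx
      simp_all [execs, Instr.exec]
    · intro x hx
      have := h2 x hx
      simp_all [execs, Instr.exec]
    · simpa [execs, Instr.exec] using h4
    · simp [execs, Instr.exec, h5, g3]
    · simp [execs, Instr.exec, RealOp.eval, hr5, hr6, gp, gq, h5, h4, h6,
        Finset.sum_range_succ]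
  · refine ⟨?_, ?_, rfl, by simp, by simp [execs, Instr.exec, RealOp.eval]⟩
    · intro x hx
      simp_all [execs, Instr.exec]
    · intro x hx
      simp_all [execs, Instr.exec]
  · simp only [List.length]
    lia
  · rintro υ ⟨h1, h2, h4, h5, h6⟩
    exact ⟨h1, h2, h4, by rw [h6, Finset.sum_range]; rfl⟩

theorem runs_applyRotProg {σ : State} {d : ℕ} (hd : σ.nat 0 = d) (h3 : σ.nat 3 = 1)
    (hpq : σ.nat 10 ≠ σ.nat 11) :
    Runs applyRotProg σ (3 + d * 14) fun τ =>
      AgreeOff {5} σ.nat τ.nat ∧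
      τ.col d (σ.nat 10) = σ.real 7 • σ.col d (σ.nat 10) - σ.real 8 • σ.col d (σ.nat 11) ∧
      τ.col d (σ.nat 11) = σ.real 8 • σ.col d (σ.nat 10) + σ.real 7 • σ.col d (σ.nat 11) ∧
      ∀ c, c ≠ σ.nat 10 → c ≠ σ.nat 11 → τ.col d c = σ.col d c := by
  refine (Runs.countLoop (N := d) (T := 11) (fun m υ =>
      AgreeOff {5} σ.nat υ.nat ∧ υ.real 7 = σ.real 7 ∧ υ.real 8 = σ.real 8 ∧ υ.nat 5 = m ∧
      (∀ l, m ≤ l → υ.mat 1 l = σ.mat 1 l) ∧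
      ∀ l < m, ∀ c, υ.mat 1 l c =
        if c = σ.nat 11 then σ.real 8 * σ.mat 1 l (σ.nat 10) + σ.real 7 * σ.mat 1 l (σ.nat 11)
        else if c = σ.nat 10 then
          σ.real 7 * σ.mat 1 l (σ.nat 10) - σ.real 8 * σ.mat 1 l (σ.nat 11)
        else σ.mat 1 l c)
      ?_ ?_ ?_).mono ?_ ?_
  · rintro m υ ⟨h1, h2, h4, h5, h6, h7⟩
    exact ⟨h5, by rw [h1 0 (by decide), hd]⟩
  · rintro m υ hm ⟨h1, h2, h4, h5, h6, h7⟩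
    refine Runs.block (by simp [Legals, Instr.Legal, RealOp.Legal]) ?_
    have g3 : υ.nat 3 = 1 := by rw [h1 3 (by decide), h3]
    have gp : υ.nat 10 = σ.nat 10 := h1 10 (by decide)
    have gq : υ.nat 11 = σ.nat 11 := h1 11 (by decide)
    refine ⟨?_, ?_, ?_, ?_, ?_, ?_⟩
    · intro x hx
      have := h1 x hx
      simp_all [execs, Instr.exec]
    · simpa [execs, Instr.exec, Function.update_apply] using h2
    · simpa [execs, Instr.exec, Function.update_apply] using h4
    · simp [execs, Instr.exec, h5, g3]
    · intro l hl
      have : l ≠ m := by omega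
      simpa [execs, Instr.exec, Function.update_apply, h5, this] using h6 l (by omega)
    · intro l hl c
      rcases Nat.lt_succ_iff_lt_or_eq.mp hl with hl | rfl
      · have : l ≠ m := by omega
        simpa [execs, Instr.exec, Function.update_apply, h5, this] using h7 l (by omega) c
      · simp [execs, Instr.exec, RealOp.eval, Function.update_apply, h2, h4, h5, gp, gq,
          h6 l le_rfl]
  · refine ⟨?_, rfl, rfl, by simp, fun _ _ => rfl, by simp⟩
    intro x hx
    simp_all
  · lia
  · rintro υ ⟨h1, h2, h4, h5, h6, h7⟩
    refine ⟨h1, ?_, ?_, ?_⟩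
    · ext l
      simp [State.col, h7 l l.2, hpq]
    · ext l
      simp [State.col, h7 l l.2]
    · intro c hc hc'
      ext l
      simp [State.col, h7 l l.2, hc, hc']

/-! ### Eliminating one row and column of a positive semidefinite matrix -/

open Matrix in
theorem col_eq_zero_of_diag_eq_zero {n : Type*} [Fintype n] [DecidableEq n] {A : Matrix n n ℝ}
    (hA : A.PosSemidef) {s : n} (hs : A s s = 0) (i : n) : A i s = 0 := by
  have h := (hA.dotProduct_mulVec_zero_iff (Pi.single s 1)).mp (by simp [hs])
  simpa using congrFun h i

/-- The column that one step of the Cholesky factorization with pivot `s` splits off. -/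
noncomputable def cholCol {n : Type*} (A : Matrix n n ℝ) (s : n) : n → ℝ :=
  fun i => A i s / √(A s s)

section Pivot

open Matrix

theorem cholCol_mul_cholCol {n : Type*} {A : Matrix n n ℝ} {s : n} (hs : 0 < A s s) (i j : n) :
    cholCol A s i * cholCol A s j = A i s * A j s / A s s := by
  rw [cholCol, cholCol, div_mul_div_comm, Real.mul_self_sqrt hs.le]

variable {n : Type*} [Fintype n] {A : Matrix n n ℝ} {s : n}

theorem dotProduct_cholCol (hA : A.PosSemidef) (x : n → ℝ) :
    cholCol A s ⬝ᵥ x = (A *ᵥ x) s / √(A s s) := by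
  simp only [dotProduct, cholCol, mulVec, Finset.sum_div]
  refine Finset.sum_congr rfl fun i _ => ?_
  rw [show A i s = A s i by simpa using hA.1.apply s i]
  ring

/-- Completing the square: the quadratic form of the Schur complement at `x` is the quadratic form
of `A` at `x` minus a multiple of the pivot's unit vector. -/
theorem PosSemidef.sub_cholCol [DecidableEq n] (hA : A.PosSemidef) (hs : 0 < A s s) :
    (A - vecMulVec (cholCol A s) (cholCol A s)).PosSemidef := by
  refine .of_dotProduct_mulVec_nonneg ?_ fun x => ?_
  · ext i j
    have := hA.1.apply i j
    simp only [star_trivial] at this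
    simp [vecMulVec_apply, this, mul_comm]
  · -- The multiple of the unit vector that minimizes the quadratic form of `A`.
    set t : ℝ := (A *ᵥ x) s / A s s with ht
    have h := hA.dotProduct_mulVec_nonneg (x - t • Pi.single s 1)
    have hsx : A.col s ⬝ᵥ x = (A *ᵥ x) s := by
      simp only [dotProduct, mulVec, col_apply]
      exact Finset.sum_congr rfl fun i _ => by
        rw [show A i s = A s i by simpa using hA.1.apply s i]
    have h1 : x ⬝ᵥ (A *ᵥ x) - 2 * t * (A *ᵥ x) s + t * t * A s s ≥ 0 := by
      have := dotProduct_comm x (A.col s)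
      simp only [star_trivial, mulVec_sub, mulVec_smul, mulVec_single_one, sub_dotProduct,
        dotProduct_sub, smul_dotProduct, dotProduct_smul, single_one_dotProduct, smul_eq_mul,
        this, hsx, col_apply] at h
      linarith
    have h2 : t * A s s = (A *ᵥ x) s := div_mul_cancel₀ _ hs.ne'
    have h3 : cholCol A s ⬝ᵥ x * (cholCol A s ⬝ᵥ x) = t * (A *ᵥ x) s := by
      rw [dotProduct_cholCol hA, div_mul_div_comm, Real.mul_self_sqrt hs.le, ht]
      ring
    rw [star_trivial, sub_mulVec, dotProduct_sub, vecMulVec_mulVec, dotProduct_comm x (_ • _),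
      op_smul_eq_smul, smul_dotProduct, smul_eq_mul, h3]
    linear_combination h1 + t * h2

/-- The kernel of `A` is contained in that of the Schur complement, which moreover contains the
unit vector of the pivot. -/
theorem rank_sub_cholCol_lt [DecidableEq n] (hA : A.PosSemidef) (hs : 0 < A s s) :
    (A - vecMulVec (cholCol A s) (cholCol A s)).rank < A.rank := by
  set B := A - vecMulVec (cholCol A s) (cholCol A s) with hB
  have hlt : A.mulVecLin.ker < B.mulVecLin.ker := by
    refine lt_of_le_of_ne (fun x hx => ?_) fun h => ?_
    · have hx' : A *ᵥ x = 0 := by simpa using hx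
      simp [hB, vecMulVec_mulVec, dotProduct_cholCol hA, hx']
    · have hmem : Pi.single s 1 ∈ B.mulVecLin.ker := by
        have : B.col s = 0 := by
          ext i
          simp [hB, vecMulVec_apply, cholCol_mul_cholCol hs, hs.ne']
        simp [this]
      rw [← h] at hmem
      have h0 : A.col s = 0 := by simpa using hmem
      exact hs.ne' (congrFun h0 s)
  have h1 := Submodule.finrank_lt_finrank_of_lt hlt
  have h2 := A.mulVecLin.finrank_range_add_finrank_ker
  have h3 := B.mulVecLin.finrank_range_add_finrank_ker
  rw [Matrix.rank, Matrix.rank]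
  omega

end Pivot

/-! ### Rotating two vectors of a family -/

/-- The family `Y` arises from `X` by a linear substitution, with cosine `c` and sine `s`, of the
members with indices `p` and `q`. -/
structure IsRotation {n : Type*} (X Y : ℕ → n → ℝ) (p q : ℕ) (c s : ℝ) : Prop where
  left : Y p = c • X p - s • X q
  right : Y q = s • X p + c • X q
  other : ∀ m, m ≠ p → m ≠ q → Y m = X m

theorem IsRotation.sum_vecMulVec {n : Type*} {X Y : ℕ → n → ℝ} {p q : ℕ} {c s : ℝ}
    (h : IsRotation X Y p q c s) (hcs : c * c + s * s = 1) {S : Finset ℕ} (hp : p ∈ S) (hq : q ∈ S)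
    (hpq : p ≠ q) :
    ∑ m ∈ S, Matrix.vecMulVec (Y m) (Y m) = ∑ m ∈ S, Matrix.vecMulVec (X m) (X m) := by
  have hq' : q ∈ S.erase p := Finset.mem_erase.mpr ⟨hpq.symm, hq⟩
  rw [← Finset.add_sum_erase _ _ hp, ← Finset.add_sum_erase _ _ hp, ← Finset.add_sum_erase _ _ hq',
    ← Finset.add_sum_erase _ _ hq', ← add_assoc, ← add_assoc]
  congr 1
  · ext i j
    simp only [h.left, h.right, Matrix.add_apply, Matrix.vecMulVec_apply, Pi.sub_apply,
      Pi.add_apply, Pi.smul_apply, smul_eq_mul]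
    linear_combination (X p i * X p j + X q i * X q j) * hcs
  · refine Finset.sum_congr rfl fun m hm => ?_
    simp only [Finset.mem_erase] at hm
    rw [h.other m hm.2.1 hm.1]

/-- The tangent of the rotation: a root of `(b - 1) t ^ 2 - 2 g t + (a - 1)`, which is real when
`a` and `b` lie on different sides of `1`. -/
noncomputable def rotTan (a b g : ℝ) : ℝ := (g + √(g * g - (a - 1) * (b - 1))) / (b - 1)

/-- The cosine belonging to `rotTan`. -/
noncomputable def rotCos (a b g : ℝ) : ℝ := 1 / √(1 + rotTan a b g * rotTan a b g)

/-- The sine belonging to `rotTan`. -/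
noncomputable def rotSin (a b g : ℝ) : ℝ := rotTan a b g * rotCos a b g

theorem rotCos_mul_self (a b g : ℝ) :
    rotCos a b g * rotCos a b g * (1 + rotTan a b g * rotTan a b g) = 1 := by
  have : 0 < 1 + rotTan a b g * rotTan a b g := by nlinarith [mul_self_nonneg (rotTan a b g)]
  rw [rotCos, div_mul_div_comm, Real.mul_self_sqrt this.le]
  field_simp

theorem rotCos_sq_add_rotSin_sq (a b g : ℝ) :
    rotCos a b g * rotCos a b g + rotSin a b g * rotSin a b g = 1 := by
  rw [← rotCos_mul_self a b g, rotSin]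
  ring

theorem rot_normSq {a b g : ℝ} (h : (a - 1) * (b - 1) ≤ 0) (hb : b ≠ 1) :
    rotCos a b g * rotCos a b g * a - 2 * (rotCos a b g * rotSin a b g) * g
      + rotSin a b g * rotSin a b g * b = 1 := by
  have hb' : b - 1 ≠ 0 := sub_ne_zero.mpr hb
  set D := g * g - (a - 1) * (b - 1) with hD
  have hD0 : 0 ≤ D := by nlinarith [mul_self_nonneg g]
  have ht : rotTan a b g * (b - 1) = g + √D := div_mul_cancel₀ _ hb'
  have hsq : √D * √D = D := Real.mul_self_sqrt hD0
  -- The defining property of the tangent, obtained after multiplication by `b - 1 ≠ 0`.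
  have hroot : (b - 1) * (rotTan a b g * rotTan a b g) - 2 * g * rotTan a b g + (a - 1) = 0 := by
    refine (mul_eq_zero.mp (?_ : (b - 1) * _ = 0)).resolve_left hb'
    linear_combination (rotTan a b g * (b - 1) + g + √D) * ht - 2 * g * ht + hsq + hD
  rw [rotSin]
  linear_combination rotCos a b g * rotCos a b g * hroot + rotCos_mul_self a b g

theorem IsRotation.left_dotProduct_self {n : Type*} [Fintype n] {X Y : ℕ → n → ℝ} {p q : ℕ}
    (h : IsRotation X Y p q (rotCos (X p ⬝ᵥ X p) (X q ⬝ᵥ X q) (X p ⬝ᵥ X q))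
      (rotSin (X p ⬝ᵥ X p) (X q ⬝ᵥ X q) (X p ⬝ᵥ X q)))
    (hs : (X p ⬝ᵥ X p - 1) * (X q ⬝ᵥ X q - 1) ≤ 0) (hq : X q ⬝ᵥ X q ≠ 1) : Y p ⬝ᵥ Y p = 1 := by
  rw [h.left, ← rot_normSq (g := X p ⬝ᵥ X q) hs hq]
  simp only [sub_dotProduct, dotProduct_sub, smul_dotProduct, dotProduct_smul, smul_eq_mul,
    dotProduct_comm (X q) (X p)]
  ring

/-! ### The Cholesky phase -/

/-- Writes `A i s / √(A s s)` for `i < d` into column `c` of the array 1, where `A` is the array 0,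
and the registers 4, 7 hold `s`, `c` and the real register 2 holds `√(A s s)`. -/
def cholColProg : Prog :=
  countLoop 5 0 (block [.setReal 3 (.load 0 5 4), .setReal 3 (.div 3 2), .store 1 5 7 3])

/-- Subtracts `y yᵀ` from the array 0, where `y` is the column of the array 1 named by the
register 7. -/
def subOuterProg : Prog :=
  countLoop 5 0 (countLoop 6 0 (block [.setReal 3 (.load 1 5 7), .setReal 4 (.load 1 6 7),
    .setReal 3 (.mul 3 4), .setReal 4 (.load 0 5 6), .setReal 4 (.sub 4 3), .store 0 5 6 4]))

/-- The Cholesky factorization: register 4 runs over the pivots, zero pivots are skipped, and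
register 7 counts the columns found so far. -/
def choleskyProg : Prog :=
  .seq (block [.setNat 7 (.const 0)])
    (countLoop 4 0 (.seq (block [.setReal 1 (.load 0 4 4), .setReal 0 (.const 0)])
      (.cond (.realEq 1 0) .skip
        (.seq (block [.setReal 2 (.sqrt 1)])
          (.seq cholColProg (.seq subOuterProg (block [.setNat 7 (.add 7 3)])))))))

theorem runs_cholColProg {σ : State} {d : ℕ} (hd : σ.nat 0 = d) (h3 : σ.nat 3 = 1)
    (h2 : σ.real 2 ≠ 0) :
    Runs cholColProg σ (3 + d * 7) fun τ =>
      AgreeOff {5} σ.nat τ.nat ∧ (∀ a ≠ 1, τ.mat a = σ.mat a) ∧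
      (∀ l : Fin d, τ.col d (σ.nat 7) l = σ.mat 0 l (σ.nat 4) / σ.real 2) ∧
      ∀ c ≠ σ.nat 7, τ.col d c = σ.col d c := by
  refine (Runs.countLoop (N := d) (T := 4) (fun m υ =>
      AgreeOff {5} σ.nat υ.nat ∧ (∀ a ≠ 1, υ.mat a = σ.mat a) ∧ υ.real 2 = σ.real 2 ∧
      υ.nat 5 = m ∧ (∀ l < m, υ.mat 1 l (σ.nat 7) = σ.mat 0 l (σ.nat 4) / σ.real 2) ∧
      ∀ l, ∀ c ≠ σ.nat 7, υ.mat 1 l c = σ.mat 1 l c) ?_ ?_ ?_).mono ?_ ?_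
  · rintro m υ ⟨g1, g2, g4, g5, g6, g7⟩
    exact ⟨g5, by rw [g1 0 (by decide), hd]⟩
  · rintro m υ hm ⟨g1, g2, g4, g5, g6, g7⟩
    refine Runs.block (by simp [Legals, Instr.Legal, RealOp.Legal, Instr.exec, g4, h2]) ?_
    have e3 : υ.nat 3 = 1 := by rw [g1 3 (by decide), h3]
    have e4 : υ.nat 4 = σ.nat 4 := g1 4 (by decide)
    have e7 : υ.nat 7 = σ.nat 7 := g1 7 (by decide)
    refine ⟨?_, ?_, ?_, ?_, ?_, ?_⟩
    · intro x hx
      have := g1 x hx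
      simp_all [execs, Instr.exec]
    · intro a ha
      simpa [execs, Instr.exec, Function.update_apply, ha] using g2 a ha
    · simpa [execs, Instr.exec, Function.update_apply] using g4
    · simp [execs, Instr.exec, g5, e3]
    · intro l hl
      rcases Nat.lt_succ_iff_lt_or_eq.mp hl with hl | rfl
      · have : l ≠ m := by omega
        simpa [execs, Instr.exec, Function.update_apply, g5, this] using g6 l hl
      · simp [execs, Instr.exec, RealOp.eval, g2, g4, g5, e4, e7]
    · intro l c hc
      have := g7 l c hc
      simp only [execs, Instr.exec, Function.update_apply, g5, e7, if_true]
      split_ifs with h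
      · simpa [Function.update_apply, hc, h] using this
      · exact this
  · refine ⟨?_, fun _ _ => rfl, rfl, by simp, by simp, fun _ _ _ => rfl⟩
    intro x hx
    simp_all
  · lia
  · rintro υ ⟨g1, g2, g4, g5, g6, g7⟩
    exact ⟨g1, g2, fun l => g6 l l.2, fun c hc => funext fun l => g7 l c hc⟩

theorem runs_subOuterProg {σ : State} {d : ℕ} (hd : σ.nat 0 = d) (h3 : σ.nat 3 = 1) :
    Runs subOuterProg σ (3 + d * (d * 10 + 6)) fun τ =>
      AgreeOff {5, 6} σ.nat τ.nat ∧ (∀ a ≠ 0, τ.mat a = σ.mat a) ∧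
      τ.work d = σ.work d - Matrix.vecMulVec (σ.col d (σ.nat 7)) (σ.col d (σ.nat 7)) := by
  refine (Runs.countLoop (N := d) (T := d * 10 + 3) (fun m υ =>
      AgreeOff {5, 6} σ.nat υ.nat ∧ (∀ a ≠ 0, υ.mat a = σ.mat a) ∧ υ.nat 5 = m ∧
      (∀ l, m ≤ l → υ.mat 0 l = σ.mat 0 l) ∧
      ∀ l < m, ∀ c < d, υ.mat 0 l c =
        σ.mat 0 l c - σ.mat 1 l (σ.nat 7) * σ.mat 1 c (σ.nat 7)) ?_ ?_ ?_).mono ?_ ?_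
  · rintro m υ ⟨h1, h2, h4, h5, h6⟩
    exact ⟨h4, by rw [h1 0 (by decide), hd]⟩
  · rintro m υ hm ⟨h1, h2, h4, h5, h6⟩
    refine (Runs.countLoop (N := d) (T := 7) (fun n ρ =>
      AgreeOff {5, 6} σ.nat ρ.nat ∧ (∀ a ≠ 0, ρ.mat a = σ.mat a) ∧ ρ.nat 5 = m ∧ ρ.nat 6 = n ∧
      (∀ l ≠ m, ρ.mat 0 l = υ.mat 0 l) ∧ (∀ c, n ≤ c → ρ.mat 0 m c = σ.mat 0 m c) ∧
      ∀ c < n, ρ.mat 0 m c = σ.mat 0 m c - σ.mat 1 m (σ.nat 7) * σ.mat 1 c (σ.nat 7))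
      ?_ ?_ ?_).mono ?_ ?_
    · rintro n ρ ⟨g1, g2, g3, g4, g5, g6, g7⟩
      exact ⟨g4, by rw [g1 0 (by decide), hd]⟩
    · rintro n ρ hn ⟨g1, g2, g3, g4, g5, g6, g7⟩
      refine Runs.block (by simp [Legals, Instr.Legal, RealOp.Legal]) ?_
      have e3 : ρ.nat 3 = 1 := by rw [g1 3 (by decide), h3]
      have e7 : ρ.nat 7 = σ.nat 7 := g1 7 (by decide)
      refine ⟨?_, ?_, ?_, ?_, ?_, ?_, ?_⟩
      · intro x hx
        have := g1 x hx
        simp_all [execs, Instr.exec]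
      · intro a ha
        simpa [execs, Instr.exec, Function.update_apply, ha] using g2 a ha
      · simpa [execs, Instr.exec] using g3
      · simp [execs, Instr.exec, g4, e3]
      · intro l hl
        simpa [execs, Instr.exec, Function.update_apply, g3, hl] using g5 l hl
      · intro c hc
        have : c ≠ n := by omega
        simpa [execs, Instr.exec, Function.update_apply, g3, g4, this] using g6 c (by omega)
      · intro c hc
        rcases Nat.lt_succ_iff_lt_or_eq.mp hc with hc | rfl
        · have : c ≠ n := by omega
          simpa [execs, Instr.exec, Function.update_apply, g3, g4, this] using g7 c hc
        · simp [execs, Instr.exec, RealOp.eval, g2, g3, g4, g6 c le_rfl, e7]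
    · refine ⟨?_, h2, by simpa using h4, by simp, fun _ _ => rfl, fun c _ => ?_, by simp⟩
      · intro x hx
        have := h1 x hx
        simp_all
      · exact congrFun (h5 m le_rfl) c
    · lia
    · rintro ρ ⟨g1, g2, g3, g4, g5, g6, g7⟩
      have e3 : ρ.nat 3 = 1 := by rw [g1 3 (by decide), h3]
      refine ⟨?_, g2, ?_, ?_, ?_⟩
      · intro x hx
        have := g1 x hx
        simp_all
      · simp [g3, e3]
      · intro l hl
        exact (g5 l (by omega)).trans (h5 l (by omega))
      · intro l hl c hc
        rcases Nat.lt_succ_iff_lt_or_eq.mp hl with hl | rfl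
        · exact (congrFun (g5 l (by omega)) c).trans (h6 l hl c hc)
        · exact g7 c hc
  · refine ⟨?_, fun _ _ => rfl, by simp, fun _ _ => rfl, by simp⟩
    intro x hx
    simp_all
  · lia
  · rintro υ ⟨h1, h2, h4, h5, h6⟩
    refine ⟨h1, h2, ?_⟩
    ext i j
    simpa [State.work, State.col, Matrix.vecMulVec_apply] using h6 i i.2 j j.2

/-- The invariant of the Cholesky phase after the first `s` pivots: the columns found so far and
the remaining positive semidefinite matrix decompose `M`, and each column found has lowered the
rank of the remaining matrix. -/
structure CholInv (d k : ℕ) (M : Matrix (Fin d) (Fin d) ℝ) (s : ℕ) (σ : State) : Prop where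
  nat0 : σ.nat 0 = d
  nat1 : σ.nat 1 = k
  nat3 : σ.nat 3 = 1
  nat4 : σ.nat 4 = s
  posSemidef : (σ.work d).PosSemidef
  rank : (σ.work d).rank + σ.nat 7 ≤ k
  done : ∀ i j : Fin d, (i : ℕ) < s → σ.work d i j = 0
  empty : ∀ c, σ.nat 7 ≤ c → c < k → σ.col d c = 0
  sum : M = σ.work d + ∑ c ∈ Finset.range k, Matrix.vecMulVec (σ.col d c) (σ.col d c)

/-- One elimination step preserves the invariant. -/
theorem CholInv.step {d k : ℕ} {M : Matrix (Fin d) (Fin d) ℝ} {σ τ : State} {s : Fin d}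
    (h : CholInv d k M s σ) (hs : 0 < σ.work d s s) (h0 : τ.nat 0 = σ.nat 0)
    (h1 : τ.nat 1 = σ.nat 1) (h3 : τ.nat 3 = σ.nat 3) (h4 : τ.nat 4 = σ.nat 4 + 1)
    (h7 : τ.nat 7 = σ.nat 7 + 1)
    (hw : τ.work d =
      σ.work d - Matrix.vecMulVec (cholCol (σ.work d) s) (cholCol (σ.work d) s))
    (hc : τ.col d (σ.nat 7) = cholCol (σ.work d) s)
    (hc' : ∀ c ≠ σ.nat 7, τ.col d c = σ.col d c) : CholInv d k M (s + 1) τ where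
  nat0 := h0.trans h.nat0
  nat1 := h1.trans h.nat1
  nat3 := h3.trans h.nat3
  nat4 := by rw [h4, h.nat4]
  posSemidef := hw ▸ PosSemidef.sub_cholCol h.posSemidef hs
  rank := by
    have h5 := rank_sub_cholCol_lt h.posSemidef hs
    have h6 := h.rank
    rw [hw, h7]
    omega
  done := by
    intro i j hi
    rw [hw, Matrix.sub_apply, Matrix.vecMulVec_apply, cholCol_mul_cholCol hs]
    have hsymm : σ.work d j s = σ.work d s j := by simpa using h.posSemidef.1.apply s j
    rcases Nat.lt_succ_iff_lt_or_eq.mp hi with hi | hi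
    · rw [h.done i j hi, h.done i s hi]
      simp
    · rw [Fin.ext hi, hsymm, mul_div_cancel_left₀ _ hs.ne', sub_self]
  empty := by
    intro c hc1 hc2
    rw [hc' c (by omega)]
    exact h.empty c (by omega) hc2
  sum := by
    have h5 := rank_sub_cholCol_lt h.posSemidef hs
    have h6 := h.rank
    -- A positive rank leaves room for one more column.
    have hk : σ.nat 7 ∈ Finset.range k := Finset.mem_range.mpr (by omega)
    have he := h.empty _ le_rfl (Finset.mem_range.mp hk)
    have hsum := h.sum
    rw [← Finset.add_sum_erase _ _ hk, he] at hsum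
    rw [← Finset.add_sum_erase _ _ hk, hc, hw, Finset.sum_congr rfl fun c hmem => by
      rw [hc' c (Finset.ne_of_mem_erase hmem)]]
    rw [← add_assoc, sub_add_cancel]
    simpa using hsum

/-- A zero pivot needs no elimination. -/
theorem CholInv.skip {d k : ℕ} {M : Matrix (Fin d) (Fin d) ℝ} {σ τ : State} {s : Fin d}
    (h : CholInv d k M s σ) (hs : σ.work d s s = 0) (h0 : τ.nat 0 = σ.nat 0)
    (h1 : τ.nat 1 = σ.nat 1) (h3 : τ.nat 3 = σ.nat 3) (h4 : τ.nat 4 = σ.nat 4 + 1)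
    (h7 : τ.nat 7 = σ.nat 7) (hm : τ.mat = σ.mat) : CholInv d k M (s + 1) τ := by
  have hw : τ.work d = σ.work d := by simp [State.work, hm]
  have hc : τ.col d = σ.col d := State.col_congr d (by rw [hm])
  refine ⟨h0.trans h.nat0, h1.trans h.nat1, h3.trans h.nat3, by rw [h4, h.nat4], hw ▸ h.posSemidef,
    by rw [hw, h7]; exact h.rank, ?_, by rw [h7, hc]; exact h.empty, by rw [hw, hc]; exact h.sum⟩
  intro i j hi
  rw [hw]
  rcases Nat.lt_succ_iff_lt_or_eq.mp hi with hi | hi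
  · exact h.done i j hi
  · rw [Fin.ext hi, ← h.posSemidef.1.apply s j]
    simpa using col_eq_zero_of_diag_eq_zero h.posSemidef hs j

theorem runs_choleskyProg {d k : ℕ} {M : Matrix (Fin d) (Fin d) ℝ} {σ : State}
    (hd : σ.nat 0 = d) (hk : σ.nat 1 = k) (h3 : σ.nat 3 = 1) (hw : σ.work d = M)
    (hc : ∀ c < k, σ.col d c = 0) (hM : M.PosSemidef) (hr : M.rank ≤ k) :
    Runs choleskyProg σ (5 + d * (d * (d * 10 + 6) + d * 7 + 17)) fun τ =>
      τ.nat 0 = d ∧ τ.nat 1 = k ∧ τ.nat 3 = 1 ∧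
      M = ∑ c ∈ Finset.range k, Matrix.vecMulVec (τ.col d c) (τ.col d c) := by
  refine (Runs.block_seq (cs := [.setNat 7 (.const 0)]) ⟨trivial, trivial⟩
    (Runs.countLoop (N := d) (T := d * (d * 10 + 6) + d * 7 + 14) (CholInv d k M)
      ?_ ?_ ?_)).mono ?_ ?_
  · exact fun m τ h => ⟨h.nat4, h.nat0⟩
  · intro m τ hm h
    have hpiv : τ.mat 0 m m = τ.work d ⟨m, hm⟩ ⟨m, hm⟩ := rfl
    have hnn : 0 ≤ τ.work d ⟨m, hm⟩ ⟨m, hm⟩ := h.posSemidef.diag_nonneg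
    refine (Runs.block_seq (cs := [.setReal 1 (.load 0 4 4), .setReal 0 (.const 0)])
      ⟨trivial, trivial, trivial⟩
      (Runs.cond (T := d * (d * 10 + 6) + d * 7 + 10) (fun hb => ?_) fun hb => ?_)).mono ?_
        fun _ => id
    · have hz : τ.work d ⟨m, hm⟩ ⟨m, hm⟩ = 0 := by
        simpa [Test.Holds, execs, Instr.exec, RealOp.eval, h.nat4, hpiv] using hb
      refine ⟨1, _, .skip, by lia, ?_⟩
      exact h.skip hz (by simp [execs, Instr.exec]) (by simp [execs, Instr.exec])
        (by simp [execs, Instr.exec]) (by simp [execs, Instr.exec, h.nat3])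
        (by simp [execs, Instr.exec]) (by simp [execs, Instr.exec])
    · have hz : τ.work d ⟨m, hm⟩ ⟨m, hm⟩ ≠ 0 := by
        simpa [Test.Holds, execs, Instr.exec, RealOp.eval, h.nat4, hpiv] using hb
      have hpos : 0 < τ.work d ⟨m, hm⟩ ⟨m, hm⟩ := lt_of_le_of_ne hnn hz.symm
      refine (Runs.block_seq (cs := [.setReal 2 (.sqrt 1)]) (by
        simpa [Legals, Instr.Legal, RealOp.Legal, execs, Instr.exec, RealOp.eval, h.nat4, hpiv]
          using hnn) (Q := fun υ => CholInv d k M (m + 1) { υ with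
            nat := Function.update υ.nat 4 (υ.nat 4 + υ.nat 3) }) ?_).mono
        (S := 2 + (3 + d * 7 + (3 + d * (d * 10 + 6) + 2))) (by lia) fun _ => id
      set ρ : State := execs (execs τ [.setReal 1 (.load 0 4 4), .setReal 0 (.const 0)])
        [.setReal 2 (.sqrt 1)] with hρ
      have r1 : ρ.nat = τ.nat := rfl
      have r2 : ρ.mat = τ.mat := rfl
      have r3 : ρ.real 2 = √(τ.work d ⟨m, hm⟩ ⟨m, hm⟩) := by
        simp [hρ, execs, Instr.exec, RealOp.eval, h.nat4, hpiv]
      refine (runs_cholColProg (r1 ▸ h.nat0) (r1 ▸ h.nat3)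
        (r3 ▸ (Real.sqrt_pos.mpr hpos).ne')).seq ?_
      rintro υ ⟨u1, u2, u3, u4⟩
      rw [r1] at u1 u3 u4
      rw [r2] at u2 u3
      refine (runs_subOuterProg ((u1 0 (by decide)).trans h.nat0)
        ((u1 3 (by decide)).trans h.nat3)).seq ?_
      rintro ξ ⟨x1, x2, x3⟩
      refine Runs.block ⟨trivial, trivial⟩ ?_
      have e (x : ℕ) (hx : x ∉ ({5, 6} : Finset ℕ)) : ξ.nat x = τ.nat x :=
        (x1 x hx).trans (u1 x fun h5 => hx (by simp [Finset.mem_singleton.mp h5]))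
      have hcol : ∀ c, ξ.col d c = υ.col d c := congrFun (State.col_congr d (x2 1 one_ne_zero))
      have hnew : υ.col d (τ.nat 7) = cholCol (τ.work d) ⟨m, hm⟩ := by
        ext l
        rw [u3 l, h.nat4, r3]
        rfl
      have hwork : υ.work d = τ.work d := by simp [State.work, u2 0 (by decide)]
      rw [u1 7 (by decide), hwork, hnew] at x3
      refine h.step hpos ?_ ?_ ?_ ?_ ?_ x3 ((hcol _).trans hnew)
        fun c hc => (hcol c).trans (u4 c hc)
      · simpa [execs, Instr.exec] using e 0 (by decide)
      · simpa [execs, Instr.exec] using e 1 (by decide)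
      · simpa [execs, Instr.exec] using e 3 (by decide)
      · simp [execs, Instr.exec, e 4 (by decide), e 3 (by decide), h.nat3]
      · simp [execs, Instr.exec, NatOp.eval, e 7 (by decide), e 3 (by decide), h.nat3]
    · simp only [List.length]
      lia
  · have hw' : State.work ({ execs σ [.setNat 7 (.const 0)] with
        nat := Function.update (execs σ [.setNat 7 (.const 0)]).nat 4 0 }) d = M := hw
    refine ⟨by simpa [execs, Instr.exec] using hd, by simpa [execs, Instr.exec] using hk,
      by simpa [execs, Instr.exec] using h3, by simp, hw' ▸ hM, ?_, ?_, fun c _ hck => hc c hck, ?_⟩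
    · rw [hw']
      simpa [execs, Instr.exec, NatOp.eval] using hr
    · simp
    · rw [hw', Finset.sum_eq_zero fun c hmem => ?_, add_zero]
      have : State.col ({ execs σ [.setNat 7 (.const 0)] with
        nat := Function.update (execs σ [.setNat 7 (.const 0)]).nat 4 0 }) d c = 0 :=
        hc c (Finset.mem_range.mp hmem)
      rw [this, Matrix.vecMulVec_zero]
  · simp only [List.length]
    lia
  · intro τ h
    refine ⟨h.nat0, h.nat1, h.nat3, ?_⟩
    have hz : τ.work d = 0 := by
      ext i j
      exact h.done i j i.2
    simpa [hz] using h.sum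

/-! ### The balancing phase -/

/-- Sets the real registers 7 and 8 to the cosine and the sine of the rotation, given the squared
norms of the two columns in the registers 11 and 12 and their inner product in the register 13. -/
def rotCoeffProg : Prog :=
  .seq (block [.setReal 14 (.const 1), .setReal 11 (.sub 11 14), .setReal 12 (.sub 12 14),
      .setReal 11 (.mul 11 12), .setReal 15 (.mul 13 13), .setReal 15 (.sub 15 11),
      .setReal 15 (.sqrt 15), .setReal 15 (.add 13 15), .setReal 15 (.div 15 12)])
    (block [.setReal 16 (.mul 15 15), .setReal 16 (.add 14 16), .setReal 16 (.sqrt 16),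
      .setReal 7 (.div 14 16), .setReal 8 (.mul 15 7)])

/-- Rotates the columns of the array 1 named by the registers 10 and 11 so that the first of them
becomes a unit vector. -/
def rotateProg : Prog :=
  .seq (dotProg 10 10 11) (.seq (dotProg 11 11 12) (.seq (dotProg 10 11 13)
    (.seq rotCoeffProg applyRotProg)))

/-- One step of the balancing phase: registers 8 and 9 are the pointers searching for a column
longer than `1` and for a column shorter than `1`. If both point to such a column, the one with the
smaller index becomes a unit vector and its pointer advances. Once the second pointer has passed
all columns, the first is moved to the end as well. -/
def balanceStep : Prog :=
  .cond (.natLt 9 1)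
    (.seq (dotProg 8 8 11) (.seq (dotProg 9 9 12) (.seq (block [.setReal 14 (.const 1)])
      (.cond (.realLt 14 11)
        (.cond (.realLt 12 14)
          (.cond (.natLt 8 9)
            (.seq (block [.setNat 10 (.copy 8), .setNat 11 (.copy 9)])
              (.seq rotateProg (block [.setNat 8 (.add 8 3)])))
            (.seq (block [.setNat 10 (.copy 9), .setNat 11 (.copy 8)])
              (.seq rotateProg (block [.setNat 9 (.add 9 3)]))))
          (block [.setNat 9 (.add 9 3)]))
        (block [.setNat 8 (.add 8 3)])))))
    (block [.setNat 8 (.copy 1)])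

/-- The balancing phase: it ends when the first pointer has passed all columns. -/
def balanceProg : Prog :=
  .seq (block [.setNat 8 (.const 0), .setNat 9 (.const 0)]) (.loop (.natLt 8 1) balanceStep)

theorem runs_rotCoeffProg {σ : State} (h : (σ.real 11 - 1) * (σ.real 12 - 1) ≤ 0)
    (h1 : σ.real 12 ≠ 1) :
    Runs rotCoeffProg σ 16 fun τ => τ.nat = σ.nat ∧ τ.mat = σ.mat ∧
      τ.real 7 = rotCos (σ.real 11) (σ.real 12) (σ.real 13) ∧
      τ.real 8 = rotSin (σ.real 11) (σ.real 12) (σ.real 13) := by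
  have hD : (σ.real 11 - 1) * (σ.real 12 - 1) ≤ σ.real 13 * σ.real 13 :=
    h.trans (mul_self_nonneg _)
  have hb : σ.real 12 - 1 ≠ 0 := sub_ne_zero.mpr h1
  refine (Runs.block (Q := fun τ => τ.nat = σ.nat ∧ τ.mat = σ.mat ∧ τ.real 14 = 1 ∧
    τ.real 15 = rotTan (σ.real 11) (σ.real 12) (σ.real 13)) ?_ ?_).seq (T := 6) ?_
  · simp [Legals, Instr.Legal, RealOp.Legal, Instr.exec, RealOp.eval, hb, hD]
  · refine ⟨rfl, rfl, ?_, ?_⟩ <;> simp [execs, Instr.exec, RealOp.eval, rotTan]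
  · rintro τ ⟨g1, g2, g3, g4⟩
    have hT : 0 < 1 + τ.real 15 * τ.real 15 := by nlinarith [mul_self_nonneg (τ.real 15)]
    refine Runs.block ?_ ⟨g1, g2, ?_, ?_⟩
    · simp [Legals, Instr.Legal, RealOp.Legal, Instr.exec, RealOp.eval, g3, hT.le,
        (Real.sqrt_pos.mpr hT).ne']
    · simp [execs, Instr.exec, RealOp.eval, rotCos, g3, g4]
    · simp [execs, Instr.exec, RealOp.eval, rotSin, rotCos, g3, g4]

theorem runs_rotateProg {σ : State} {d : ℕ} (hd : σ.nat 0 = d) (h3 : σ.nat 3 = 1)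
    (hpq : σ.nat 10 ≠ σ.nat 11)
    (hs : (σ.col d (σ.nat 10) ⬝ᵥ σ.col d (σ.nat 10) - 1) *
      (σ.col d (σ.nat 11) ⬝ᵥ σ.col d (σ.nat 11) - 1) ≤ 0)
    (hq : σ.col d (σ.nat 11) ⬝ᵥ σ.col d (σ.nat 11) ≠ 1) :
    Runs rotateProg σ (34 + d * 38) fun τ =>
      AgreeOff {5} σ.nat τ.nat ∧
      τ.col d (σ.nat 10) ⬝ᵥ τ.col d (σ.nat 10) = 1 ∧
      (∀ c, c ≠ σ.nat 10 → c ≠ σ.nat 11 → τ.col d c = σ.col d c) ∧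
      ∀ S : Finset ℕ, σ.nat 10 ∈ S → σ.nat 11 ∈ S →
        ∑ c ∈ S, Matrix.vecMulVec (τ.col d c) (τ.col d c) =
          ∑ c ∈ S, Matrix.vecMulVec (σ.col d c) (σ.col d c) := by
  set a := σ.col d (σ.nat 10) ⬝ᵥ σ.col d (σ.nat 10) with ha
  set b := σ.col d (σ.nat 11) ⬝ᵥ σ.col d (σ.nat 11) with hb
  set g := σ.col d (σ.nat 10) ⬝ᵥ σ.col d (σ.nat 11) with hg
  refine ((runs_dotProg hd h3 (p := 10) (q := 10) (r := 11) (by decide) (by decide) (by decide)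
    (by decide)).seq (T := 29 + d * 30) ?_).mono (by lia) fun _ => id
  rintro τ₁ ⟨n1, r1, m1, v1⟩
  refine ((runs_dotProg ((n1 0 (by decide)).trans hd) ((n1 3 (by decide)).trans h3) (p := 11)
    (q := 11) (r := 12) (by decide) (by decide) (by decide) (by decide)).seq
    (T := 24 + d * 22) ?_).mono (by lia) fun _ => id
  rintro τ₂ ⟨n2, r2, m2, v2⟩
  have n2' : AgreeOff {5} σ.nat τ₂.nat := fun x hx => (n2 x hx).trans (n1 x hx)
  refine ((runs_dotProg ((n2' 0 (by decide)).trans hd) ((n2' 3 (by decide)).trans h3) (p := 10)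
    (q := 11) (r := 13) (by decide) (by decide) (by decide) (by decide)).seq
    (T := 19 + d * 14) ?_).mono (by lia) fun _ => id
  rintro τ₃ ⟨n3, r3, m3, v3⟩
  have n3' : AgreeOff {5} σ.nat τ₃.nat := fun x hx => (n3 x hx).trans (n2' x hx)
  have m3' : τ₃.mat = σ.mat := by rw [m3, m2, m1]
  have c1 : τ₁.col d = σ.col d := State.col_congr d (by rw [m1])
  have c2 : τ₂.col d = σ.col d := State.col_congr d (by rw [m2, m1])
  have va : τ₃.real 11 = a := by
    rw [r3 11 (by decide), r2 11 (by decide), v1]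
  have vb : τ₃.real 12 = b := by
    rw [r3 12 (by decide), v2, c1, n1 11 (by decide)]
  have vg : τ₃.real 13 = g := by
    rw [v3, c2, n2' 10 (by decide), n2' 11 (by decide)]
  rw [← va, ← vb] at hs
  rw [← vb] at hq
  refine ((runs_rotCoeffProg hs hq).seq (T := 3 + d * 14) ?_).mono (by lia) fun _ => id
  rintro ρ ⟨pn, pm, p7, p8⟩
  rw [va, vb, vg] at p7 p8
  rw [va, vb] at hs
  rw [vb] at hq
  have pc : ρ.col d = σ.col d := State.col_congr d (by rw [pm, m3'])
  have pn' : AgreeOff {5} σ.nat ρ.nat := pn ▸ n3'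
  have e10 : ρ.nat 10 = σ.nat 10 := pn' 10 (by decide)
  have e11 : ρ.nat 11 = σ.nat 11 := pn' 11 (by decide)
  refine (runs_applyRotProg ((pn' 0 (by decide)).trans hd) ((pn' 3 (by decide)).trans h3)
    (by rwa [e10, e11])).mono le_rfl ?_
  rintro τ ⟨t1, t2, t3, t4⟩
  rw [e10, e11, pc, p7, p8] at t2 t3
  rw [e10, e11, pc] at t4
  have hrot : IsRotation (σ.col d) (τ.col d) (σ.nat 10) (σ.nat 11) (rotCos a b g)
    (rotSin a b g) := ⟨t2, t3, t4⟩
  exact ⟨fun x hx => (t1 x hx).trans (pn' x hx), hrot.left_dotProduct_self hs hq, t4,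
    fun S hp hq' => hrot.sum_vecMulVec (rotCos_sq_add_rotSin_sq a b g) hp hq' hpq⟩

/-- The invariant of the balancing phase: the columns still decompose `M`, those before the first
pointer (register 8) have norm at most `1`, and those before the second (register 9) at least `1`.
The norms are squared. -/
structure BalInv (d k : ℕ) (M : Matrix (Fin d) (Fin d) ℝ) (σ : State) : Prop where
  nat0 : σ.nat 0 = d
  nat1 : σ.nat 1 = k
  nat3 : σ.nat 3 = 1
  nat8 : σ.nat 8 ≤ k
  nat9 : σ.nat 9 ≤ k
  short : ∀ c < σ.nat 8, σ.col d c ⬝ᵥ σ.col d c ≤ 1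
  long : ∀ c < σ.nat 9, 1 ≤ σ.col d c ⬝ᵥ σ.col d c
  sum : M = ∑ c ∈ Finset.range k, Matrix.vecMulVec (σ.col d c) (σ.col d c)

theorem BalInv.sum_normSq {d k : ℕ} {M : Matrix (Fin d) (Fin d) ℝ} {σ : State}
    (h : BalInv d k M σ) : ∑ c ∈ Finset.range k, σ.col d c ⬝ᵥ σ.col d c = M.trace := by
  rw [h.sum, Matrix.trace_sum]
  simp only [Matrix.trace_vecMulVec]

/-- If the second pointer has passed all columns, then all have norm at least `1`; by the trace
bound all norms equal `1`. -/
theorem BalInv.le_one_of_nat9_eq {d k : ℕ} {M : Matrix (Fin d) (Fin d) ℝ} {σ : State}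
    (h : BalInv d k M σ) (hM : M.trace ≤ k) (h9 : σ.nat 9 = k) {c : ℕ} (hc : c < k) :
    σ.col d c ⬝ᵥ σ.col d c ≤ 1 := by
  by_contra! hlt
  have : ∑ c ∈ Finset.range k, (1 : ℝ) < ∑ c ∈ Finset.range k, σ.col d c ⬝ᵥ σ.col d c :=
    Finset.sum_lt_sum (fun i hi => h.long i (h9 ▸ Finset.mem_range.mp hi))
      ⟨c, Finset.mem_range.mpr hc, hlt⟩
  rw [h.sum_normSq] at this
  simp only [Finset.sum_const, Finset.card_range, nsmul_eq_mul, mul_one] at this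
  linarith

/-- Advancing the pointers without touching the columns. -/
theorem BalInv.advance {d k : ℕ} {M : Matrix (Fin d) (Fin d) ℝ} {σ τ : State}
    (h : BalInv d k M σ) (h0 : τ.nat 0 = σ.nat 0) (h1 : τ.nat 1 = σ.nat 1)
    (h3 : τ.nat 3 = σ.nat 3) (hm : τ.col d = σ.col d) (h8 : τ.nat 8 ≤ k) (h9 : τ.nat 9 ≤ k)
    (hs : ∀ c, σ.nat 8 ≤ c → c < τ.nat 8 → σ.col d c ⬝ᵥ σ.col d c ≤ 1)
    (hl : ∀ c, σ.nat 9 ≤ c → c < τ.nat 9 → 1 ≤ σ.col d c ⬝ᵥ σ.col d c) : BalInv d k M τ where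
  nat0 := h0.trans h.nat0
  nat1 := h1.trans h.nat1
  nat3 := h3.trans h.nat3
  nat8 := h8
  nat9 := h9
  short c hc := by
    rw [hm]
    exact (lt_or_ge c (σ.nat 8)).elim (h.short c) fun hge => hs c hge hc
  long c hc := by
    rw [hm]
    exact (lt_or_ge c (σ.nat 9)).elim (h.long c) fun hge => hl c hge hc
  sum := hm ▸ h.sum

/-- A step keeps the invariant and brings the pointers closer to the end. In the rotating branches
the column made a unit vector satisfies both bounds, and the other column lies before neither
pointer. -/
theorem runs_balanceStep {d k : ℕ} {M : Matrix (Fin d) (Fin d) ℝ} {σ : State}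
    (hM : M.trace ≤ k) (h : BalInv d k M σ) (h8 : σ.nat 8 < k) :
    Runs balanceStep σ (55 + d * 54) fun τ => BalInv d k M τ ∧
      k - τ.nat 8 + (k - τ.nat 9) < k - σ.nat 8 + (k - σ.nat 9) := by
  refine (Runs.cond (T := 54 + d * 54) (fun hb => ?_) fun hb => ?_).mono (by lia) fun _ => id
  · have h9 : σ.nat 9 < k := by simpa [Test.Holds, h.nat1] using hb
    refine ((runs_dotProg h.nat0 h.nat3 (p := 8) (q := 8) (r := 11) (by decide) (by decide)
      (by decide) (by decide)).seq (T := 49 + d * 46) ?_).mono (by lia) fun _ => id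
    rintro τ₁ ⟨n1, r1, m1, v1⟩
    refine ((runs_dotProg ((n1 0 (by decide)).trans h.nat0) ((n1 3 (by decide)).trans h.nat3)
      (p := 9) (q := 9) (r := 12) (by decide) (by decide) (by decide) (by decide)).seq
      (T := 44 + d * 38) ?_).mono (by lia) fun _ => id
    rintro τ₂ ⟨n2, r2, m2, v2⟩
    refine (Runs.block_seq (T := 42 + d * 38) (by simp [Legals, Instr.Legal, RealOp.Legal]) ?_).mono
      (by simp only [List.length]; lia) fun _ => id
    set ρ := execs τ₂ _ with hρ
    have pn : AgreeOff {5} σ.nat ρ.nat := fun x hx => (n2 x hx).trans (n1 x hx)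
    have pc : ρ.col d = σ.col d := State.col_congr d (congrFun (m2.trans m1) 1)
    have c1 : τ₁.col d = σ.col d := State.col_congr d (by rw [m1])
    have p11 : ρ.real 11 = σ.col d (σ.nat 8) ⬝ᵥ σ.col d (σ.nat 8) := by
      rw [← v1, ← r2 11 (by decide)]
      simp [hρ, execs, Instr.exec]
    have p12 : ρ.real 12 = σ.col d (σ.nat 9) ⬝ᵥ σ.col d (σ.nat 9) := by
      rw [← c1, ← n1 9 (by decide), ← v2]
      simp [hρ, execs, Instr.exec]
    have p14 : ρ.real 14 = 1 := by simp [hρ, execs, Instr.exec, RealOp.eval]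
    have e8 : ρ.nat 8 = σ.nat 8 := pn 8 (by decide)
    have e9 : ρ.nat 9 = σ.nat 9 := pn 9 (by decide)
    have e3 : ρ.nat 3 = 1 := (pn 3 (by decide)).trans h.nat3
    have e0 : ρ.nat 0 = d := (pn 0 (by decide)).trans h.nat0
    have e1 : ρ.nat 1 = k := (pn 1 (by decide)).trans h.nat1
    clear_value ρ
    refine (Runs.cond (T := 41 + d * 38) (fun ha => ?_) fun ha => ?_).mono (by lia) fun _ => id
    · have ha : 1 < σ.col d (σ.nat 8) ⬝ᵥ σ.col d (σ.nat 8) := by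
        simpa [Test.Holds, p11, p14] using ha
      refine (Runs.cond (T := 40 + d * 38) (fun hb => ?_) fun hb => ?_).mono (by lia) fun _ => id
      · have hb : σ.col d (σ.nat 9) ⬝ᵥ σ.col d (σ.nat 9) < 1 := by
          simpa [Test.Holds, p12, p14] using hb
        have hne : σ.nat 8 ≠ σ.nat 9 := fun he => by
          rw [he] at ha
          exact lt_asymm ha hb
        have hs : (σ.col d (σ.nat 8) ⬝ᵥ σ.col d (σ.nat 8) - 1) *
            (σ.col d (σ.nat 9) ⬝ᵥ σ.col d (σ.nat 9) - 1) ≤ 0 :=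
          mul_nonpos_of_nonneg_of_nonpos (by linarith) (by linarith)
        refine (Runs.cond (T := 39 + d * 38) (fun hij => ?_) fun hij => ?_).mono (by lia)
          fun _ => id
        · have hij : σ.nat 8 < σ.nat 9 := by simpa [Test.Holds, e8, e9] using hij
          refine (Runs.block_seq (T := 36 + d * 38) (by simp [Legals, Instr.Legal]) ?_).mono
            (by simp only [List.length]; lia) fun _ => id
          set ξ := execs ρ _ with hξ
          have x10 : ξ.nat 10 = σ.nat 8 := by simp [hξ, execs, Instr.exec, NatOp.eval, e8]
          have x11 : ξ.nat 11 = σ.nat 9 := by simp [hξ, execs, Instr.exec, NatOp.eval, e9]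
          have x0 : ξ.nat 0 = d := by simp [hξ, execs, Instr.exec, e0]
          have x1 : ξ.nat 1 = k := by simp [hξ, execs, Instr.exec, e1]
          have x3 : ξ.nat 3 = 1 := by simp [hξ, execs, Instr.exec, e3]
          have x8 : ξ.nat 8 = σ.nat 8 := by simp [hξ, execs, Instr.exec, e8]
          have x9 : ξ.nat 9 = σ.nat 9 := by simp [hξ, execs, Instr.exec, e9]
          have xc : ξ.col d = σ.col d := pc
          clear_value ξ
          refine ((runs_rotateProg x0 x3 (by rwa [x10, x11]) (by rwa [x10, x11, xc])
            (by rw [x11, xc]; exact hb.ne)).seq (T := 2) ?_).mono (by lia) fun _ => id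
          rintro υ ⟨u1, u2, u3, u4⟩
          rw [x10] at u2
          rw [x10, x11, xc] at u3
          rw [x10, x11, xc] at u4
          refine Runs.block ⟨trivial, trivial⟩ ?_
          have w8 : υ.nat 8 = σ.nat 8 := (u1 8 (by decide)).trans x8
          have w9 : υ.nat 9 = σ.nat 9 := (u1 9 (by decide)).trans x9
          have w3 : υ.nat 3 = 1 := (u1 3 (by decide)).trans x3
          set ζ := execs υ _ with hζ
          have z8 : ζ.nat 8 = σ.nat 8 + 1 := by simp [hζ, execs, Instr.exec, NatOp.eval, w8, w3]
          have z9 : ζ.nat 9 = σ.nat 9 := by simp [hζ, execs, Instr.exec, w9]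
          have zc : ζ.col d = υ.col d := rfl
          refine ⟨⟨?_, ?_, ?_, ?_, ?_, ?_, ?_, ?_⟩, by omega⟩
          · simp [hζ, execs, Instr.exec, u1 0 (by decide), x0]
          · simp [hζ, execs, Instr.exec, u1 1 (by decide), x1]
          · simp [hζ, execs, Instr.exec, w3]
          · omega
          · omega
          · intro c hc
            rw [zc]
            rcases Nat.lt_succ_iff_lt_or_eq.mp (z8 ▸ hc) with hc | rfl
            · rw [u3 c (by omega) (by omega)]
              exact h.short c hc
            · exact u2.le
          · intro c hc
            rw [zc]
            rw [z9] at hc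
            by_cases hc' : c = σ.nat 8
            · rw [hc', u2]
            · rw [u3 c hc' (by omega)]
              exact h.long c hc
          · rw [zc, u4 _ (Finset.mem_range.mpr h8) (Finset.mem_range.mpr h9)]
            exact h.sum
        · have hij : σ.nat 9 < σ.nat 8 := by
            have : ¬ σ.nat 8 < σ.nat 9 := by simpa [Test.Holds, e8, e9] using hij
            omega
          refine (Runs.block_seq (T := 36 + d * 38) (by simp [Legals, Instr.Legal]) ?_).mono
            (by simp only [List.length]; lia) fun _ => id
          set ξ := execs ρ _ with hξ
          have x10 : ξ.nat 10 = σ.nat 9 := by simp [hξ, execs, Instr.exec, NatOp.eval, e9]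
          have x11 : ξ.nat 11 = σ.nat 8 := by simp [hξ, execs, Instr.exec, NatOp.eval, e8]
          have x0 : ξ.nat 0 = d := by simp [hξ, execs, Instr.exec, e0]
          have x1 : ξ.nat 1 = k := by simp [hξ, execs, Instr.exec, e1]
          have x3 : ξ.nat 3 = 1 := by simp [hξ, execs, Instr.exec, e3]
          have x8 : ξ.nat 8 = σ.nat 8 := by simp [hξ, execs, Instr.exec, e8]
          have x9 : ξ.nat 9 = σ.nat 9 := by simp [hξ, execs, Instr.exec, e9]
          have xc : ξ.col d = σ.col d := pc
          clear_value ξ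
          refine ((runs_rotateProg x0 x3 (by rw [x10, x11]; exact hne.symm)
            (by rwa [x10, x11, xc, mul_comm])
            (by rw [x11, xc]; exact ha.ne')).seq (T := 2) ?_).mono (by lia) fun _ => id
          rintro υ ⟨u1, u2, u3, u4⟩
          rw [x10] at u2
          rw [x10, x11, xc] at u3
          rw [x10, x11, xc] at u4
          refine Runs.block ⟨trivial, trivial⟩ ?_
          have w8 : υ.nat 8 = σ.nat 8 := (u1 8 (by decide)).trans x8
          have w9 : υ.nat 9 = σ.nat 9 := (u1 9 (by decide)).trans x9
          have w3 : υ.nat 3 = 1 := (u1 3 (by decide)).trans x3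
          set ζ := execs υ _ with hζ
          have z8 : ζ.nat 8 = σ.nat 8 := by simp [hζ, execs, Instr.exec, w8]
          have z9 : ζ.nat 9 = σ.nat 9 + 1 := by simp [hζ, execs, Instr.exec, NatOp.eval, w9, w3]
          have zc : ζ.col d = υ.col d := rfl
          refine ⟨⟨?_, ?_, ?_, ?_, ?_, ?_, ?_, ?_⟩, by omega⟩
          · simp [hζ, execs, Instr.exec, u1 0 (by decide), x0]
          · simp [hζ, execs, Instr.exec, u1 1 (by decide), x1]
          · simp [hζ, execs, Instr.exec, w3]
          · omega
          · omega
          · intro c hc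
            rw [zc]
            rw [z8] at hc
            by_cases hc' : c = σ.nat 9
            · rw [hc', u2]
            · rw [u3 c hc' (by omega)]
              exact h.short c hc
          · intro c hc
            rw [zc]
            rcases Nat.lt_succ_iff_lt_or_eq.mp (z9 ▸ hc) with hc | rfl
            · rw [u3 c (by omega) (by omega)]
              exact h.long c hc
            · exact u2.ge
          · rw [zc, u4 _ (Finset.mem_range.mpr h9) (Finset.mem_range.mpr h8)]
            exact h.sum
      · have hb : 1 ≤ σ.col d (σ.nat 9) ⬝ᵥ σ.col d (σ.nat 9) := by
          simpa [Test.Holds, p12, p14] using hb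
        refine (Runs.block (by simp [Legals, Instr.Legal]) ?_).mono
          (by simp only [List.length]; lia) fun _ => id
        set ζ := execs ρ _ with hζ
        have z8 : ζ.nat 8 = σ.nat 8 := by simp [hζ, execs, Instr.exec, e8]
        have z9 : ζ.nat 9 = σ.nat 9 + 1 := by simp [hζ, execs, Instr.exec, NatOp.eval, e9, e3]
        refine ⟨h.advance ?_ ?_ ?_ pc (by omega) (by omega) (fun c hc hc' => by omega) ?_, by omega⟩
        · simp [hζ, execs, Instr.exec, e0, h.nat0]
        · simp [hζ, execs, Instr.exec, e1, h.nat1]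
        · simp [hζ, execs, Instr.exec, e3, h.nat3]
        · intro c hc hc'
          rwa [show c = σ.nat 9 by omega]
    · have ha : σ.col d (σ.nat 8) ⬝ᵥ σ.col d (σ.nat 8) ≤ 1 := by
        simpa [Test.Holds, p11, p14] using ha
      refine (Runs.block (by simp [Legals, Instr.Legal]) ?_).mono
        (by simp only [List.length]; lia) fun _ => id
      set ζ := execs ρ _ with hζ
      have z9 : ζ.nat 9 = σ.nat 9 := by simp [hζ, execs, Instr.exec, e9]
      have z8 : ζ.nat 8 = σ.nat 8 + 1 := by simp [hζ, execs, Instr.exec, NatOp.eval, e8, e3]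
      refine ⟨h.advance ?_ ?_ ?_ pc (by omega) (by omega) ?_ fun c hc hc' => by omega, by omega⟩
      · simp [hζ, execs, Instr.exec, e0, h.nat0]
      · simp [hζ, execs, Instr.exec, e1, h.nat1]
      · simp [hζ, execs, Instr.exec, e3, h.nat3]
      · intro c hc hc'
        rwa [show c = σ.nat 8 by omega]
  · have h9 : σ.nat 9 = k := by
      have : ¬ σ.nat 9 < k := by simpa [Test.Holds, h.nat1] using hb
      have := h.nat9
      omega
    refine (Runs.block (by simp [Legals, Instr.Legal]) ?_).mono
      (by simp only [List.length]; lia) fun _ => id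
    set ζ := execs σ _ with hζ
    have z9 : ζ.nat 9 = σ.nat 9 := by simp [hζ, execs, Instr.exec]
    have z8 : ζ.nat 8 = k := by simp [hζ, execs, Instr.exec, NatOp.eval, h.nat1]
    refine ⟨h.advance ?_ ?_ ?_ rfl (by omega) (by omega)
      (fun c _ hc => h.le_one_of_nat9_eq hM h9 (z8 ▸ hc)) fun c hc hc' => by omega, by omega⟩
    · simp [hζ, execs, Instr.exec]
    · simp [hζ, execs, Instr.exec]
    · simp [hζ, execs, Instr.exec]

theorem runs_balanceProg {d k : ℕ} {M : Matrix (Fin d) (Fin d) ℝ} {σ : State}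
    (hd : σ.nat 0 = d) (hk : σ.nat 1 = k) (h3 : σ.nat 3 = 1) (hM : M.trace ≤ k)
    (hs : M = ∑ c ∈ Finset.range k, Matrix.vecMulVec (σ.col d c) (σ.col d c)) :
    Runs balanceProg σ (4 + (k + k) * (56 + d * 54)) fun τ =>
      (∀ c < k, τ.col d c ⬝ᵥ τ.col d c ≤ 1) ∧
      M = ∑ c ∈ Finset.range k, Matrix.vecMulVec (τ.col d c) (τ.col d c) := by
  refine (Runs.block_seq (by simp [Legals, Instr.Legal]) (Runs.loop (T := 55 + d * 54)
    (BalInv d k M) (fun τ => k - τ.nat 8 + (k - τ.nat 9)) (fun τ h hb => ?_) ?_)).mono ?_ ?_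
  · exact runs_balanceStep hM h (by simpa [Test.Holds, h.nat1] using hb)
  · refine ⟨?_, ?_, ?_, ?_, ?_, ?_, ?_, hs⟩ <;> simp [execs, Instr.exec, NatOp.eval, hd, hk, h3]
  · simp [execs, Instr.exec, NatOp.eval]
    lia
  · rintro τ ⟨h, hb⟩
    refine ⟨fun c hc => h.short c ?_, h.sum⟩
    simp only [Test.Holds, h.nat1] at hb
    omega

/-- The whole program. Register 3 holds the constant `1` throughout. -/
def mainProg : Prog :=
  .seq (block [.setNat 3 (.const 1)]) (.seq clearProg (.seq choleskyProg balanceProg))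

end RealRAM

theorem mainTheorem9 :
    ∃ (p : RealRAM.Prog) (C : ℕ),
      ∀ (d k : ℕ) (M : Matrix (Fin d) (Fin d) ℝ), 1 ≤ d →
        M.PosSemidef → M.trace ≤ (k : ℝ) → M.rank ≤ k →
        ∀ σ : RealRAM.State, σ.IsInput d k M →
          ∃ (t : ℕ) (τ : RealRAM.State), RealRAM.Exec p σ t τ ∧
            t ≤ C * (d ^ 3 + k * d) ∧
            (∀ i : Fin k, τ.output d k i ∈ Metric.closedBall (0 : EuclideanSpace ℝ (Fin d)) 1) ∧
            M = ∑ i : Fin k, Matrix.vecMulVec (τ.output d k i) (τ.output d k i) := by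
  refine ⟨RealRAM.mainProg, 300, fun d k M hd1 hM htr hrk σ ⟨hd, hk, hin⟩ => ?_⟩
  have hrun : RealRAM.Runs RealRAM.mainProg σ (300 * (d ^ 3 + k * d)) fun τ =>
      (∀ c < k, τ.col d c ⬝ᵥ τ.col d c ≤ 1) ∧
      M = ∑ c ∈ Finset.range k, Matrix.vecMulVec (τ.col d c) (τ.col d c) := by
    have hrun := RealRAM.Runs.block_seq (cs := [.setNat 3 (.const 1)]) ⟨trivial, trivial⟩
      ((RealRAM.runs_clearProg (σ := RealRAM.execs σ [.setNat 3 (.const 1)]) (d := d) (k := k)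
        (by simpa [RealRAM.execs, RealRAM.Instr.exec] using hd)
        (by simpa [RealRAM.execs, RealRAM.Instr.exec] using hk)
        (by simp [RealRAM.execs, RealRAM.Instr.exec, RealRAM.NatOp.eval])).seq
      (fun τ ⟨h1, h2, h4⟩ => (RealRAM.runs_choleskyProg (d := d) (k := k) (M := M)
        (by simpa [RealRAM.execs, RealRAM.Instr.exec, hd] using h1 0 (by decide))
        (by simpa [RealRAM.execs, RealRAM.Instr.exec, hk] using h1 1 (by decide))
        (by simpa [RealRAM.execs, RealRAM.Instr.exec, RealRAM.NatOp.eval] using h1 3 (by decide))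
        (by ext i j; exact (congrFun₂ (h2 0 (by decide)) i j).trans (hin i j))
        (fun c hc => funext fun l => h4 l l.2 c hc) hM hrk).seq
      fun υ ⟨g0, g1, g3, gs⟩ => RealRAM.runs_balanceProg g0 g1 g3 htr gs))
    refine hrun.mono ?_ fun _ => id
    -- The lower-order terms are absorbed because `d` is positive.
    have e1 : d ≤ d ^ 3 := Nat.le_self_pow (by decide) d
    have e2 : d ^ 2 ≤ d ^ 3 := Nat.pow_le_pow_right hd1 (by decide)
    have e3 : k ≤ k * d := Nat.le_mul_of_pos_right k hd1
    simp only [List.length]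
    nlinarith
  obtain ⟨t, τ, ht, hT, hnorm, hsum⟩ := hrun
  refine ⟨t, τ, ht, hT, fun i => ?_, ?_⟩
  · rw [mem_closedBall_zero_iff, EuclideanSpace.norm_eq, Real.sqrt_le_one]
    refine le_trans (le_of_eq ?_) (hnorm i i.2)
    simp [RealRAM.State.output, RealRAM.State.col, dotProduct, pow_two]
  · rw [hsum, Finset.sum_range]
    rfl
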